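/- Setting. Fix reals $0<q_1<q_0\le 1$. Let $G$ be a simple $d$-regular graph ($d\ge1$) on $n$ vertices (agents). In the biased 2-choices process each agent has, at each time $t=0,1,2,\dots$, an opinion in $\{0,1\}$; at each step all agents act simultaneously and, given the current configuration, independently: an agent with opinion $i$ keeps it with probability $1-q_i$, and with probability $q_i$ it samples two of its neighbours uniformly at random with replacement and adopts the majority opinion among itself and the two sampled neighbours. This is a Markov chain on $\{0,1\}^n$. Let $A(0)$ be the number of agents with opinion $1$ at time $0$ (the initial configuration is deterministic), and let $\lambda_n\ge 0$ be the second largest, counted with multiplicity, of the absolute values of the eigenvalues of the scaled adjacency matrix $\frac1d\,\mathrm{Adj}(G)$. For $\lambda\in(0,1)$, a $\lambda$-expander family of regular graphs is a sequence of regular graphs of positive degree, with strictly increasing numbers $n$ of vertices, all satisfying $\lambda_n\le\lambda$; we write $G_n$ for the member with $n$ vertices. Theorem. There is an absolute constant $K>0$ such that the following holds. Let $0<q_1<q_0\le1$, $c\in\left(0,\frac{q_0}{q_0+q_1}\right)$ and $0<\gamma\le c$. Then there are $\alpha\in(0,1)$ and $C>0$, depending only on $q_0,q_1,\gamma,c$,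 such that for every $\lambda$-expander family $\{G_n\}_n$ of regular graphs with $\lambda^2\le \frac{q_0}{q_0+q_1}-c$, for every member $G_n$ of it and every initial configuration with $$\frac{q_1}{q_0+q_1}+\max\left(\lambda_n^2,\sqrt{\frac{\log n}{4n}}\right)\ \le\ \frac{A(0)}{n}\ \le\ 1-\gamma ,$$ the biased 2-choices process on $G_n$ reaches, with probability at least $1-C/n^{\alpha}$, consensus on opinion $1$ (all agents have opinion $1$ from then on) within at most $$K\,\frac{\log n}{\log\frac{1}{1-q_1c\left(\frac{q_0}{q_0+q_1}-\gamma\right)}}$$ time steps. -/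

import Mathlib

open MeasureTheory

noncomputable section

namespace BiasedTwoChoices

open scoped Classical in
/-- The scaled adjacency matrix `A / d` of a (`d`-regular) graph. -/
def scaledAdj {V : Type*} [Fintype V] (G : SimpleGraph V) (d : ℕ) : Matrix V V ℝ :=
  (d : ℝ)⁻¹ • G.adjMatrix ℝ

theorem scaledAdj_isHermitian {V : Type*} [Fintype V] (G : SimpleGraph V) (d : ℕ) :
    (scaledAdj G d).IsHermitian := by
  classical
  rw [Matrix.IsHermitian, Matrix.conjTranspose_eq_transpose_of_trivial, scaledAdj,
    Matrix.transpose_smul, SimpleGraph.transpose_adjMatrix]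

open scoped Classical in
/-- The absolute values of the eigenvalues of the scaled adjacency matrix, listed with
multiplicity in decreasing order. -/
def absEigenvalues {V : Type*} [Fintype V] (G : SimpleGraph V) (d : ℕ) : List ℝ :=
  ((Finset.univ : Finset V).val.map
    fun i => |(scaledAdj_isHermitian G d).eigenvalues i|).sort (· ≥ ·)

/-- The second largest absolute value of an eigenvalue of the scaled adjacency matrix
(counted with multiplicity; the value `0` on graphs with fewer than two vertices is irrelevant). -/
def secondEigenvalue {V : Type*} [Fintype V] (G : SimpleGraph V) (d : ℕ) : ℝ :=
  (absEigenvalues G d).getD 1 0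

open scoped Classical in
/-- A `lam`-expander family of regular graphs with increasing numbers of vertices:
`G k` has `N k` vertices and is regular of positive degree `d k`, and the second largest
eigenvalue in absolute value of its scaled adjacency matrix is at most `lam`. -/
structure IsExpanderFamily (lam : ℝ) (N d : ℕ → ℕ) (G : (k : ℕ) → SimpleGraph (Fin (N k))) :
    Prop where
  lam_pos : 0 < lam
  lam_lt_one : lam < 1
  strictMono : StrictMono N
  degree_pos : ∀ k, 0 < d k
  regular : ∀ k, (G k).IsRegularOfDegree (d k)
  second_le : ∀ k, secondEigenvalue (G k) (d k) ≤ lam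

/-- The majority opinion of three agents; `true` is opinion `1`, `false` is opinion `0`. -/
def majority (a b c : Bool) : Bool := decide (2 ≤ a.toNat + b.toNat + c.toNat)

/-- The probability that an agent with opinion `i` updates. -/
def updateProb (q₀ q₁ : ℝ) (i : Bool) : ℝ := if i then q₁ else q₀

open scoped Classical in
/-- The neighbours of `u`. -/
def nbrs {V : Type*} [Fintype V] (G : SimpleGraph V) (u : V) : Finset V :=
  Finset.univ.filter (G.Adj u)

/-- The probability that agent `u` has opinion `b` at the next step if the current configuration
is `x`: it keeps its opinion `i` with probability `1 - q_i`, and with probability `q_i` it samples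
two neighbours `v`, `w` independently and uniformly, with replacement, and adopts the majority
opinion among `u`, `v`, `w`. -/
def agentProb {V : Type*} [Fintype V] (G : SimpleGraph V) (q₀ q₁ : ℝ) (x : V → Bool) (u : V)
    (b : Bool) : ℝ :=
  (1 - updateProb q₀ q₁ (x u)) * (if x u = b then 1 else 0) +
  updateProb q₀ q₁ (x u) *
    ((∑ v ∈ nbrs G u, ∑ w ∈ nbrs G u, if majority (x u) (x v) (x w) = b then (1 : ℝ) else 0) /
      ((nbrs G u).card : ℝ) ^ 2)

/-- The transition probability of the chain: all agents move simultaneously and, given the current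
configuration, independently. -/
def transProb {V : Type*} [Fintype V] (G : SimpleGraph V) (q₀ q₁ : ℝ) (x y : V → Bool) : ℝ :=
  ∏ u, agentProb G q₀ q₁ x u (y u)

/-- `X` is a version, on the probability space `(Ω, μ)`, of the biased 2-choices process on `G`
started at the configuration `x₀`: the Markov chain on `{0,1}^V` with the transition
probabilities above. -/
structure IsProcess {V : Type*} [Fintype V] (G : SimpleGraph V) (q₀ q₁ : ℝ) (x₀ : V → Bool)
    {Ω : Type*} [MeasurableSpace Ω] (μ : Measure Ω) (X : ℕ → Ω → V → Bool) : Prop where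
  measurable : ∀ t, Measurable (X t)
  path : ∀ (t : ℕ) (y : ℕ → V → Bool),
    μ.real {ω | ∀ s ≤ t, X s ω = y s} =
      if y 0 = x₀ then ∏ s ∈ Finset.range t, transProb G q₀ q₁ (y s) (y (s + 1)) else 0

/-- The number of agents with opinion `1`. -/
def numOnes {V : Type*} [Fintype V] (x : V → Bool) : ℕ :=
  (Finset.univ.filter fun u => x u = true).card

end BiasedTwoChoices

end

noncomputable section

namespace BiasedTwoChoices

open Finset

/-! Let `β` be the fraction of zeros, `L` the squared second eigenvalue, `p = q₁ / (q₀ + q₁)`, and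
`F u` the fraction of ones among the neighbours of `u`. A one turns to zero with probability `q₁ (1
- F u)²`, a zero stays zero with probability `1 - q₀ (F u)²`. Completing a square bounds both by
expressions with the same quadratic part `q₁ (F² - 2F)`, so the mean of the next `β` needs only `∑
F`, which regularity gives exactly, and `∑ F²`, which the spectral gap bounds. The result
(`sum_agentProb_false_div_card_le`) is a logistic drift: the mean is at most `β - q₁ (1 - L) β (b -
β)`, where `b` is the critical fraction and `(1 - L) b ≥ c`.

With `κ = q₁ c / 4` this gives two phases. While `β > b / 2`, the distance `b - β` grows in mean by
a factor `1 + 2κ`; once `β ≤ b / 2`, `β` itself shrinks in mean by a factor `1 - 2κ`. Given the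
configuration the agents are independent, so a Chernoff bound keeps the fluctuation of one step
within half of this drift. The initial distance is at least `b √(log n / (4n))`
(`criticalFrac_mul_le`), just large enough for each step to fail with only polynomially small
probability. About `log n / κ` steps suffice for each phase; the first moment of the number of zeros
ends the second one, and consensus is absorbing.

Both phases are inductions on the number of remaining steps for expectations under the kernel
(`iterExpect_le_of_contraction`, `iterExpect_le_of_growth`), without stopping times. -/

/-- The number of agents with opinion `0`, as a real number. -/
def numZeros {V : Type*} [Fintype V] (x : V → Bool) : ℝ :=
  ∑ u, if x u = false then 1 else 0

/-! ### Independent Bernoulli opinions: mean and Chernoff bound. -/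

section ProductWeights

variable {V : Type*} [Fintype V] {p : V → Bool → ℝ}

theorem sum_prod_eq_prod_sum [DecidableEq V] (p : V → Bool → ℝ) :
    ∑ y : V → Bool, ∏ u, p u (y u) = ∏ u, (p u true + p u false) := by
  have h := Finset.prod_univ_sum (fun _ : V => (univ : Finset Bool)) p
  simp only [Fintype.piFinset_univ, Fintype.sum_bool] at h
  exact h.symm

theorem sum_prod_weights [DecidableEq V] (hp : ∀ u, p u true + p u false = 1) :
    ∑ y : V → Bool, ∏ u, p u (y u) = 1 := by
  simp [sum_prod_eq_prod_sum, hp]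

/-- The mean number of zeros under a product of Bernoulli weights. -/
theorem sum_prod_weights_mul_numZeros [DecidableEq V] (hp : ∀ u, p u true + p u false = 1) :
    ∑ y : V → Bool, (∏ u, p u (y u)) * numZeros y = ∑ u, p u false := by
  simp only [numZeros, mul_sum]
  rw [sum_comm]
  refine sum_congr rfl fun v _ => ?_
  -- Altering the weights at `v` alone inserts the indicator of a zero at `v` into the product.
  have h := sum_prod_eq_prod_sum
    (fun u b => p u b * if u = v then (if b = false then 1 else 0) else 1)
  simp only [prod_mul_distrib, prod_ite_eq', mem_univ, if_true] at h
  rw [h, prod_eq_single v]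
  · simp
  · intro u _ huv
    simp [huv, hp]
  · simp

/-- A Chernoff bound for the number of zeros under a product of Bernoulli weights. -/
theorem sum_prod_weights_upper_tail [DecidableEq V] (hp : ∀ u, p u true + p u false = 1)
    (hp0 : ∀ u b, 0 ≤ p u b) {δ : ℝ} (hδ : 0 ≤ δ) (hδ2 : δ ≤ 2) :
    ∑ y : V → Bool with ∑ u, p u false + δ * Fintype.card V < numZeros y, ∏ u, p u (y u) ≤
      Real.exp (-(δ ^ 2 * Fintype.card V / 4)) := by
  -- This `θ` minimises `θ² n - θ δ n`; `δ ≤ 2` gives `θ ≤ 1`, where `exp θ ≤ 1 + θ + θ²`.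
  set θ := δ / 2 with hθ
  set R := ∑ u, p u false with hR
  set n : ℝ := (Fintype.card V : ℝ) with hn
  have hmgf : ∑ y : V → Bool, (∏ u, p u (y u)) * Real.exp (θ * numZeros y) ≤
      Real.exp (θ * R + θ ^ 2 * n) := by
    have h := sum_prod_eq_prod_sum
      (fun u b => p u b * Real.exp (θ * if b = false then 1 else 0))
    simp only [prod_mul_distrib, ← Real.exp_sum, ← mul_sum] at h
    calc _ = _ := h
      _ ≤ ∏ u, Real.exp (θ * p u false + θ ^ 2) := by
        refine prod_le_prod (fun u _ => ?_) fun u _ => ?_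
        · have h1 := hp0 u true
          have h2 := hp0 u false
          positivity
        · have h1 := hp0 u true
          have h2 := hp0 u false
          have he : Real.exp θ ≤ 1 + θ + θ ^ 2 := by
            have := Real.abs_exp_sub_one_sub_id_le (x := θ) (by rw [abs_le]; constructor <;> linarith)
            linarith [(abs_le.1 this).2]
          have h3 : p u false ≤ 1 := by linarith [hp u]
          have h4 := Real.add_one_le_exp (θ * p u false + θ ^ 2)
          simp only [Bool.true_eq_false, if_false, if_true, mul_zero, Real.exp_zero, mul_one]
          nlinarith [hp u, sq_nonneg θ]
      _ = _ := by
        rw [← Real.exp_sum, sum_add_distrib, ← mul_sum]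
        simp [hR, hn, mul_comm]
  have hw : ∀ y : V → Bool, 0 ≤ ∏ u, p u (y u) := fun y => prod_nonneg fun u _ => hp0 u _
  calc _ ≤ ∑ y : V → Bool with R + δ * n < numZeros y,
        Real.exp (-(θ * (R + δ * n))) * ((∏ u, p u (y u)) * Real.exp (θ * numZeros y)) := by
        refine sum_le_sum fun y hy => ?_
        rw [mul_left_comm, ← Real.exp_add]
        refine le_mul_of_one_le_right (hw y) (Real.one_le_exp ?_)
        have := (mem_filter.1 hy).2
        nlinarith
    _ ≤ ∑ y : V → Bool,
        Real.exp (-(θ * (R + δ * n))) * ((∏ u, p u (y u)) * Real.exp (θ * numZeros y)) := by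
        refine sum_le_sum_of_subset_of_nonneg (filter_subset _ _) fun y _ _ => ?_
        have := hw y
        positivity
    _ ≤ Real.exp (-(θ * (R + δ * n))) * Real.exp (θ * R + θ ^ 2 * n) := by
        rw [← mul_sum]
        gcongr
    _ = _ := by
        rw [← Real.exp_add]
        congr 1
        rw [hθ]
        ring

end ProductWeights

/-! ### Contraction of mean-zero vectors by the second eigenvalue. -/

section Spectral

theorem secondEigenvalue_nonneg {V : Type*} [Fintype V] (G : SimpleGraph V) (d : ℕ) :
    0 ≤ secondEigenvalue G d := by
  classical
  rw [secondEigenvalue, List.getD_eq_getElem?_getD]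
  rcases h : (absEigenvalues G d)[1]? with _ | a
  · simp
  · have ha := List.mem_of_getElem? h
    simp only [absEigenvalues, Multiset.mem_sort, Multiset.mem_map] at ha
    obtain ⟨i, -, rfl⟩ := ha
    simp

/-- In a decreasing list at most one entry exceeds the entry of index `1`. -/
theorem length_filter_lt_getD_one_le (l : List ℝ) (hl : l.Pairwise (· ≥ ·)) :
    (l.filter fun a => l.getD 1 0 < a).length ≤ 1 := by
  match l, hl with
  | [], _ => simp
  | [a], _ => simpa using List.length_filter_le (fun a => decide ((0 : ℝ) < a)) [a]
  | a :: b :: t, hl =>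
    have hb : ∀ x ∈ b :: t, x ≤ b := by
      intro x hx
      rcases List.mem_cons.1 hx with rfl | hx
      · exact le_rfl
      · exact List.rel_of_pairwise_cons (List.pairwise_cons.1 hl).2 hx
    have h : (b :: t).filter (fun x => decide (b < x)) = [] := by
      rw [List.filter_eq_nil_iff]
      intro x hx
      simpa using hb x hx
    have h1 : (a :: b :: t).getD 1 0 = b := rfl
    rw [h1, List.filter_cons, h]
    split <;> simp

open scoped Classical in
/-- At most one eigenvalue exceeds the second one in absolute value. -/
theorem abs_eigenvalues_le_secondEigenvalue {V : Type*} [Fintype V] (G : SimpleGraph V) (d : ℕ)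
    {i j : V} (hi : secondEigenvalue G d < |(scaledAdj_isHermitian G d).eigenvalues i|)
    (hij : j ≠ i) : |(scaledAdj_isHermitian G d).eigenvalues j| ≤ secondEigenvalue G d := by
  by_contra! hj
  have h := length_filter_lt_getD_one_le (absEigenvalues G d)
    (Multiset.pairwise_sort _ _)
  have h2 : ((absEigenvalues G d).filter fun a => secondEigenvalue G d < a).length =
      #{k : V | secondEigenvalue G d < |(scaledAdj_isHermitian G d).eigenvalues k|} := by
    rw [← Multiset.coe_card, ← Multiset.filter_coe, absEigenvalues, Multiset.sort_eq,
      Multiset.filter_map, Multiset.card_map]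
    rfl
  rw [secondEigenvalue] at h2 hi hj
  rw [h2, card_le_one] at h
  exact hij (h j (by simpa using hj) i (by simpa using hi))

open scoped Classical in
theorem scaledAdj_mulVec_apply {V : Type*} [Fintype V] (G : SimpleGraph V) (d : ℕ) (w : V → ℝ)
    (u : V) : (scaledAdj G d).mulVec w u = (∑ v ∈ nbrs G u, w v) / d := by
  rw [scaledAdj, Matrix.smul_mulVec, Pi.smul_apply, SimpleGraph.adjMatrix_mulVec_apply,
    smul_eq_mul, div_eq_inv_mul]
  congr 2
  ext v
  simp [nbrs]

theorem scaledAdj_mulVec_one {V : Type*} [Fintype V] {G : SimpleGraph V} {d : ℕ}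
    (hd : ∀ u, (nbrs G u).card = d) (hd0 : 0 < d) :
    (scaledAdj G d).mulVec (fun _ => 1) = fun _ => 1 := by
  ext u
  rw [scaledAdj_mulVec_apply]
  have : (d : ℝ) ≠ 0 := by positivity
  simp [hd, this]

theorem sum_scaledAdj_mulVec_mul {V : Type*} [Fintype V] (G : SimpleGraph V) (d : ℕ)
    (v w : V → ℝ) :
    ∑ u, (scaledAdj G d).mulVec v u * w u = ∑ u, v u * (scaledAdj G d).mulVec w u := by
  have h := (scaledAdj_isHermitian G d).eq
  rw [Matrix.conjTranspose_eq_transpose_of_trivial] at h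
  change (scaledAdj G d).mulVec v ⬝ᵥ w = v ⬝ᵥ (scaledAdj G d).mulVec w
  rw [Matrix.dotProduct_mulVec, ← Matrix.mulVec_transpose, h]

/-- On vectors of mean zero the scaled adjacency matrix contracts by the second eigenvalue. -/
theorem sum_sq_scaledAdj_mulVec_le {V : Type*} [Fintype V] {G : SimpleGraph V} {d : ℕ}
    (hone : (scaledAdj G d).mulVec (fun _ => 1) = fun _ => 1)
    (hlam : secondEigenvalue G d < 1) (w : V → ℝ) (hw : ∑ u, w u = 0) :
    ∑ u, (scaledAdj G d).mulVec w u ^ 2 ≤ secondEigenvalue G d ^ 2 * ∑ u, w u ^ 2 := by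
  classical
  set hA := scaledAdj_isHermitian G d
  set e := hA.eigenvectorBasis
  set ev := hA.eigenvalues
  have hin : ∀ (i : V) (v : V → ℝ), inner ℝ (e i) (WithLp.toLp 2 v) = ∑ u, v u * e i u := by
    intro i v
    simp [PiLp.inner_apply]
  have hmul : ∀ (i : V) (v : V → ℝ), ∑ u, (scaledAdj G d).mulVec v u * e i u =
      ev i * ∑ u, v u * e i u := by
    intro i v
    have h2 := hA.mulVec_eigenvectorBasis i
    have h1 := sum_scaledAdj_mulVec_mul G d v (e i)
    rw [h1, h2, mul_sum]
    refine sum_congr rfl fun u _ => ?_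
    simp only [Pi.smul_apply, smul_eq_mul]
    ring
  have hpars : ∀ v : V → ℝ, ∑ u, v u ^ 2 = ∑ i, (∑ u, v u * e i u) ^ 2 := by
    intro v
    have h := e.sum_sq_norm_inner_right (WithLp.toLp 2 v)
    simp only [hin, EuclideanSpace.real_norm_sq_eq, Real.norm_eq_abs, sq_abs] at h
    exact h.symm
  -- The constants are fixed by the symmetric matrix, so eigenvectors of other eigenvalues are
  -- orthogonal to them.
  have hone' : ∀ i, ev i = 1 ∨ ∑ u, e i u = 0 := by
    intro i
    have h := hmul i (fun _ => 1)
    rw [hone] at h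
    simp only [one_mul] at h
    by_cases h0 : ∑ u, e i u = 0
    · exact Or.inr h0
    · exact Or.inl (mul_right_cancel₀ h0 (by linarith))
  rw [hpars, hpars w, mul_sum]
  refine sum_le_sum fun i _ => ?_
  rw [hmul, mul_pow]
  by_cases hi : |ev i| ≤ secondEigenvalue G d
  · exact mul_le_mul_of_nonneg_right (sq_le_sq' (by linarith [neg_abs_le (ev i)])
      ((le_abs_self _).trans hi)) (sq_nonneg _)
  -- All other eigenvalues are then below `1` in absolute value, so their eigenvectors are
  -- orthogonal to the constants. Hence the constants lie on the line of `e i`, and the mean-zero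
  -- `w` has no component along it.
  · push Not at hi
    have hz : ∀ j, j ≠ i → ∑ u, e j u = 0 := by
      intro j hj
      refine (hone' j).resolve_left fun h1 => ?_
      have := abs_eigenvalues_le_secondEigenvalue G d hi hj
      change |ev j| ≤ _ at this
      rw [h1, abs_one] at this
      linarith
    have hsum := e.sum_inner_mul_inner (WithLp.toLp 2 w) (WithLp.toLp 2 fun _ : V => (1 : ℝ))
    rw [sum_eq_single i (fun j _ hj => by rw [hin j]; simp [hz j hj]) (by simp)] at hsum
    rw [real_inner_comm, hin, hin] at hsum
    simp only [PiLp.inner_apply, one_mul] at hsum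
    have hw' : (∑ u, w u * e i u) * ∑ u, e i u = 0 := by
      rw [hsum]
      simpa using hw
    have h1 : (∑ u, e i u) ^ 2 = Fintype.card V := by
      have h := hpars fun _ => 1
      simp only [one_mul] at h
      have h' := sum_eq_single (f := fun j => (∑ u, e j u) ^ 2) (s := univ) i
        (fun j _ hj => by simp [hz j hj]) (by simp)
      rw [← h', ← h]
      simp
    have hne : ∑ u, e i u ≠ 0 := by
      intro h0
      rw [h0] at h1
      have : 0 < Fintype.card V := Fintype.card_pos_iff.2 ⟨i⟩
      have : (0 : ℝ) < Fintype.card V := by exact_mod_cast this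
      nlinarith
    rw [(mul_eq_zero.1 hw').resolve_right hne]
    simp

end Spectral

/-! ### One-step drift of the number of zeros. -/

section Drift

variable {V : Type*} [Fintype V] {G : SimpleGraph V} {d : ℕ} {q₀ q₁ : ℝ}

/-- The fraction of neighbours of `u` with opinion `1`. -/
def nbrFrac (G : SimpleGraph V) (d : ℕ) (x : V → Bool) (u : V) : ℝ :=
  (scaledAdj G d).mulVec (fun v => if x v = true then 1 else 0) u

theorem nbrFrac_mul (hd0 : 0 < d) (x : V → Bool) (u : V) :
    nbrFrac G d x u * d = ∑ v ∈ nbrs G u, if x v = true then (1 : ℝ) else 0 := by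
  rw [nbrFrac, scaledAdj_mulVec_apply]
  have : (d : ℝ) ≠ 0 := by positivity
  field_simp

theorem agentProb_false (hd : ∀ u, (nbrs G u).card = d) (hd0 : 0 < d) (x : V → Bool) (u : V) :
    agentProb G q₀ q₁ x u false =
      if x u = true then q₁ * (1 - nbrFrac G d x u) ^ 2 else 1 - q₀ * nbrFrac G d x u ^ 2 := by
  have hdr : (d : ℝ) ≠ 0 := by positivity
  have hf := nbrFrac_mul (G := G) hd0 x u
  set F := nbrFrac G d x u
  rcases hx : x u
  · have h : ∀ v w, (if majority false (x v) (x w) = false then (1 : ℝ) else 0) =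
        1 - (if x v = true then 1 else 0) * (if x w = true then 1 else 0) := by
      intro v w
      cases x v <;> cases x w <;> simp [majority]
    simp only [agentProb, hx, h, updateProb, sum_sub_distrib, ← mul_sum, ← sum_mul, ← hf, hd,
      sum_const, nsmul_eq_mul]
    simp only [Bool.false_eq_true, if_false, if_true]
    field_simp
    ring
  · have h : ∀ v w, (if majority true (x v) (x w) = false then (1 : ℝ) else 0) =
        (1 - if x v = true then 1 else 0) * (1 - if x w = true then 1 else 0) := by
      intro v w
      cases x v <;> cases x w <;> simp [majority]
    simp only [agentProb, hx, h, updateProb, ← mul_sum, ← sum_mul, sum_sub_distrib, ← hf, hd,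
      sum_const, nsmul_eq_mul]
    simp only [Bool.true_eq_false, if_false, if_true]
    field_simp
    ring

theorem agentProb_true_add_false (hd : ∀ u, (nbrs G u).card = d) (hd0 : 0 < d) (x : V → Bool)
    (u : V) : agentProb G q₀ q₁ x u true + agentProb G q₀ q₁ x u false = 1 := by
  have hdr : (d : ℝ) ≠ 0 := by positivity
  have h : ∀ b : Bool, (if b = true then (1 : ℝ) else 0) + (if b = false then 1 else 0) = 1 := by
    rintro (_ | _) <;> simp
  have h2 : (∑ v ∈ nbrs G u, ∑ w ∈ nbrs G u,
        if majority (x u) (x v) (x w) = true then (1 : ℝ) else 0) +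
      (∑ v ∈ nbrs G u, ∑ w ∈ nbrs G u,
        if majority (x u) (x v) (x w) = false then (1 : ℝ) else 0) = (d : ℝ) ^ 2 := by
    simp only [← sum_add_distrib, h]
    simp [hd, sq]
  have h3 := congrArg (· / (d : ℝ) ^ 2) h2
  simp only [add_div, div_self (pow_ne_zero 2 hdr)] at h3
  rw [agentProb, agentProb, hd]
  linear_combination (1 - updateProb q₀ q₁ (x u)) * h (x u) + updateProb q₀ q₁ (x u) * h3

theorem agentProb_nonneg (h0 : 0 ≤ q₀) (h1 : 0 ≤ q₁) (h0' : q₀ ≤ 1) (h1' : q₁ ≤ 1)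
    (x : V → Bool) (u : V) (b : Bool) : 0 ≤ agentProb G q₀ q₁ x u b := by
  have hu : 0 ≤ updateProb q₀ q₁ (x u) ∧ 0 ≤ 1 - updateProb q₀ q₁ (x u) := by
    rw [updateProb]
    split <;> constructor <;> linarith
  obtain ⟨hu, hu'⟩ := hu
  rw [agentProb]
  positivity

theorem numOnes_eq (x : V → Bool) :
    (numOnes x : ℝ) = ∑ u, if x u = true then (1 : ℝ) else 0 := by
  simp [numOnes]

theorem numOnes_add_numZeros (x : V → Bool) :
    (numOnes x : ℝ) + numZeros x = Fintype.card V := by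
  rw [numOnes_eq, numZeros, ← sum_add_distrib]
  have : ∀ u, ((if x u = true then (1 : ℝ) else 0) + if x u = false then 1 else 0) = 1 := by
    intro u
    cases x u <;> simp
  simp [this]

theorem sum_nbrFrac (hd : ∀ u, (nbrs G u).card = d) (hd0 : 0 < d) (x : V → Bool) :
    ∑ u, nbrFrac G d x u = numOnes x := by
  have h := sum_scaledAdj_mulVec_mul G d (fun v => if x v = true then 1 else 0) (fun _ => 1)
  rw [scaledAdj_mulVec_one hd hd0] at h
  simp only [mul_one] at h
  rw [numOnes_eq, ← h]
  rfl

/-- Split the indicator of the ones into its mean and a mean-zero part. Averaging over neighbours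
fixes the first and contracts the second, whose squared norm is `numOnes x * numZeros x / n`. -/
theorem sum_sq_nbrFrac_le (hd : ∀ u, (nbrs G u).card = d) (hd0 : 0 < d)
    (hlam : secondEigenvalue G d < 1) (hV : 0 < Fintype.card V) (x : V → Bool) :
    ∑ u, nbrFrac G d x u ^ 2 ≤ (numOnes x : ℝ) ^ 2 / Fintype.card V +
      secondEigenvalue G d ^ 2 * (numOnes x * numZeros x / Fintype.card V) := by
  have hn : (0 : ℝ) < Fintype.card V := by exact_mod_cast hV
  set n : ℝ := (Fintype.card V : ℝ) with hndef
  set a : ℝ := numOnes x / n with ha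
  have hAn : (numOnes x : ℝ) = a * n := by rw [ha]; field_simp
  have hB : numZeros x = n - a * n := by linarith [numOnes_add_numZeros x]
  set w : V → ℝ := fun v => (if x v = true then 1 else 0) - a with hw
  have hw0 : ∑ u, w u = 0 := by
    rw [hw, sum_sub_distrib, ← numOnes_eq, hAn]
    simp [← hndef, mul_comm]
  have hPw : ∀ u, (scaledAdj G d).mulVec w u = nbrFrac G d x u - a := by
    intro u
    have h1 : w = (fun v => if x v = true then 1 else 0) - a • fun _ => (1 : ℝ) := by
      ext v
      simp [hw]
    rw [h1, Matrix.mulVec_sub, Matrix.mulVec_smul, scaledAdj_mulVec_one hd hd0]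
    simp [nbrFrac]
  have hws : ∑ u, w u ^ 2 = a * n - a ^ 2 * n := by
    have : ∀ u, w u ^ 2 = (1 - 2 * a) * (if x u = true then 1 else 0) + a ^ 2 := by
      intro u
      simp only [hw]
      split <;> ring
    simp only [this, sum_add_distrib, ← mul_sum, ← numOnes_eq, hAn, sum_const, nsmul_eq_mul,
      card_univ, ← hndef]
    ring
  have h := sum_sq_scaledAdj_mulVec_le (scaledAdj_mulVec_one hd hd0) hlam w hw0
  have h2 : ∑ u, (scaledAdj G d).mulVec w u ^ 2 = ∑ u, nbrFrac G d x u ^ 2 - a ^ 2 * n := by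
    have : ∀ u, (scaledAdj G d).mulVec w u ^ 2 =
        nbrFrac G d x u ^ 2 - (2 * a) * nbrFrac G d x u + a ^ 2 := by
      intro u
      rw [hPw]
      ring
    simp only [this, sum_add_distrib, sum_sub_distrib, ← mul_sum, sum_nbrFrac hd hd0, hAn,
      sum_const, nsmul_eq_mul, card_univ, ← hndef]
    ring
  rw [h2, hws] at h
  have h3 : (a * n) ^ 2 / n = a ^ 2 * n := by field_simp
  have h4 : a * n * (n - a * n) / n = a * n - a ^ 2 * n := by field_simp
  rw [hAn, hB, h3, h4]
  linarith

/-- The expected number of zeros after one step. -/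
theorem sum_agentProb_false_le (hd : ∀ u, (nbrs G u).card = d) (hd0 : 0 < d)
    (hlam : secondEigenvalue G d < 1) (hV : 0 < Fintype.card V) (h0 : 0 < q₀) (h1 : 0 < q₁)
    (x : V → Bool) :
    ∑ u, agentProb G q₀ q₁ x u false ≤ numZeros x - q₁ * numZeros x *
      ((1 - secondEigenvalue G d ^ 2) * (1 - numZeros x / Fintype.card V) - q₁ / (q₀ + q₁)) := by
  have hn : (0 : ℝ) < Fintype.card V := by exact_mod_cast hV
  have hF := sum_sq_nbrFrac_le hd hd0 hlam hV x
  have hA := numOnes_add_numZeros x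
  have hsum := sum_nbrFrac hd hd0 x
  set n : ℝ := (Fintype.card V : ℝ) with hndef
  set p := q₁ / (q₀ + q₁) with hp
  have hpq : p * (q₀ + q₁) = q₁ := by rw [hp]; field_simp
  set L := secondEigenvalue G d ^ 2
  -- Equality for ones; for zeros the two sides differ by `(q₀ + q₁) (F - p)²`. The quadratic in `F`
  -- no longer depends on the opinion of `u`.
  have hpt : ∀ u, agentProb G q₀ q₁ x u false ≤
      (1 + q₁ * p) * (if x u = false then 1 else 0) +
        q₁ * ((if x u = true then 1 else 0) + nbrFrac G d x u ^ 2 - 2 * nbrFrac G d x u) := by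
    intro u
    rw [agentProb_false hd hd0]
    rcases x u
    · simp only [Bool.false_eq_true, if_false, if_true]
      have h2 : 0 ≤ (q₀ + q₁) * (nbrFrac G d x u - p) ^ 2 := by positivity
      have h3 : (q₀ + q₁) * (nbrFrac G d x u - p) ^ 2 =
          (q₀ + q₁) * nbrFrac G d x u ^ 2 - 2 * q₁ * nbrFrac G d x u + q₁ * p := by
        linear_combination (p - 2 * nbrFrac G d x u) * hpq
      linarith
    · simp only [Bool.true_eq_false, if_false, if_true]
      nlinarith
  refine (sum_le_sum fun u _ => hpt u).trans ?_
  simp only [sum_add_distrib, sum_sub_distrib, ← mul_sum, ← numOnes_eq, hsum]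
  rw [← numZeros]
  have hA' : (numOnes x : ℝ) = n - numZeros x := by linarith
  rw [hA'] at hF ⊢
  set B := numZeros x
  have h3 : (n - B) ^ 2 / n + L * ((n - B) * B / n) =
      (n - B) - (1 - L) * (B * (1 - B / n)) := by
    field_simp
    ring
  rw [h3] at hF
  nlinarith

theorem transProb_consensus (hd : ∀ u, (nbrs G u).card = d) (hd0 : 0 < d)
    {z : V → Bool} (hz : z ≠ fun _ => true) : transProb G q₀ q₁ (fun _ => true) z = 0 := by
  obtain ⟨u, hu⟩ := Function.ne_iff.1 hz
  have hu' : z u = false := by simpa using hu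
  refine prod_eq_zero (mem_univ u) ?_
  have h1 : nbrFrac G d (fun _ => true) u = 1 := by
    have h := congrFun (scaledAdj_mulVec_one hd hd0) u
    simpa [nbrFrac] using h
  rw [hu', agentProb_false hd hd0, h1]
  simp

end Drift

/-! ### Growth and contraction phases for a finite Markov chain. -/

section Kernel

variable {S : Type*} [Fintype S] {P : S → S → ℝ}

/-- The expectation of `f` after `s` steps of a finite Markov chain with kernel `P`, as a function
of the starting point. -/
def iterExpect (P : S → S → ℝ) (f : S → ℝ) : ℕ → S → ℝ
  | 0, x => f x
  | s + 1, x => ∑ y, P x y * iterExpect P f s y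

theorem iterExpect_le_one (hP : ∀ x y, 0 ≤ P x y) (hP1 : ∀ x, ∑ y, P x y = 1) {f : S → ℝ}
    (hf : ∀ x, f x ≤ 1) (s : ℕ) (x : S) : iterExpect P f s x ≤ 1 := by
  induction s generalizing x with
  | zero => exact hf x
  | succ s ih =>
    rw [← hP1 x]
    exact sum_le_sum fun y _ => mul_le_of_le_one_right (hP x y) (ih y)

/-- One step of a chain, split according to an exceptional set `{y | w < β y}`. -/
theorem sum_mul_le_add_of_le (hP : ∀ x y, 0 ≤ P x y) {β g k : S → ℝ} {w ε : ℝ} {x : S}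
    (hε : ∑ y with w < β y, P x y ≤ ε) (hg1 : ∀ y, g y ≤ 1) (hk : ∀ y, 0 ≤ k y)
    (hgk : ∀ y, β y ≤ w → g y ≤ k y) : ∑ y, P x y * g y ≤ ε + ∑ y, P x y * k y := by
  refine le_trans ?_ (add_le_add_left hε _)
  rw [sum_filter, ← sum_add_distrib]
  refine sum_le_sum fun y _ => ?_
  split_ifs with h
  · nlinarith [mul_le_of_le_one_right (hP x y) (hg1 y), mul_nonneg (hP x y) (hk y)]
  · rw [zero_add]
    exact mul_le_mul_of_nonneg_left (hgk y (not_lt.1 h)) (hP x y)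

variable {f β : S → ℝ} {n w ρ ε : ℝ}

/-- The bound is linear in `β`, so averaging it over one step only uses the mean of `β`. Leaving `{β
≤ w}`, where nothing is assumed, costs `ε` per step because the expectation never exceeds `1`. -/
theorem iterExpect_le_of_contraction (hP : ∀ x y, 0 ≤ P x y) (hP1 : ∀ x, ∑ y, P x y = 1)
    (hf1 : ∀ x, f x ≤ 1) (hβ : ∀ x, 0 ≤ β x) (hn : 0 ≤ n)
    (hfβ : ∀ x, f x ≤ n * β x) (hρ : 0 ≤ ρ) (hε : 0 ≤ ε)
    (hmean : ∀ x, β x ≤ w → ∑ y, P x y * β y ≤ ρ * β x)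
    (hleave : ∀ x, β x ≤ w → ∑ y with w < β y, P x y ≤ ε) (s : ℕ) (x : S) (hx : β x ≤ w) :
    iterExpect P f s x ≤ s * ε + ρ ^ s * n * β x := by
  induction s generalizing x with
  | zero => simpa [iterExpect] using hfβ x
  | succ s ih =>
    have h := sum_mul_le_add_of_le hP (hleave x hx) (iterExpect_le_one hP hP1 hf1 s)
      (fun y => by have := hβ y; positivity) ih
    refine h.trans ?_
    simp only [mul_add, sum_add_distrib]
    rw [← sum_mul, hP1]
    have h2 : ∑ y, P x y * (ρ ^ s * n * β y) = ρ ^ s * n * ∑ y, P x y * β y := by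
      rw [mul_sum]
      exact sum_congr rfl fun y _ => by ring
    have h3 := mul_le_mul_of_nonneg_left (hmean x hx) (by positivity : 0 ≤ ρ ^ s * n)
    rw [h2]
    push_cast
    calc _ ≤ ε + (1 * (s * ε) + ρ ^ s * n * (ρ * β x)) := by gcongr
      _ = _ := by ring

/-- A growth phase, in which the distance of `β` from `b` increases geometrically, followed by a
contraction phase. -/
theorem iterExpect_le_of_growth (hP : ∀ x y, 0 ≤ P x y) (hP1 : ∀ x, ∑ y, P x y = 1)
    (hf1 : ∀ x, f x ≤ 1) (hβ : ∀ x, 0 ≤ β x) (hβ1 : ∀ x, β x ≤ 1) (hn : 0 ≤ n)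
    (hfβ : ∀ x, f x ≤ n * β x) (hρ : 0 ≤ ρ) (hρ1 : ρ ≤ 1) (hε : 0 ≤ ε) {b η₀ κ : ℝ} (hκ : 0 ≤ κ)
    (hη₀ : 0 ≤ η₀)
    (hmean : ∀ x, β x ≤ b / 2 → ∑ y, P x y * β y ≤ ρ * β x)
    (hleave : ∀ x, β x ≤ b / 2 → ∑ y with b / 2 < β y, P x y ≤ ε)
    (hgrow : ∀ x, b / 2 < β x → η₀ ≤ b - β x →
      ∑ y with b - (1 + κ) * (b - β x) < β y, P x y ≤ ε)
    (j s : ℕ) (x : S) (η : ℝ) (hη : η₀ ≤ η) (hx : η ≤ b - β x) (hj : b / 2 ≤ η * (1 + κ) ^ j) :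
    iterExpect P f (j + s) x ≤ (j + s : ℕ) * ε + ρ ^ s * n := by
  -- Reaching `b / 2` early is harmless: the unused growth steps are spent contracting.
  have hlow : ∀ j x, β x ≤ b / 2 →
      iterExpect P f (j + s) x ≤ (j + s : ℕ) * ε + ρ ^ s * n := by
    intro j x hx
    have h := iterExpect_le_of_contraction hP hP1 hf1 hβ hn hfβ hρ hε hmean hleave (j + s) x hx
    refine h.trans ?_
    have h1 : ρ ^ (j + s) * n * β x ≤ ρ ^ s * n * 1 := by
      gcongr ?_ * n * ?_
      · exact hβ x
      · exact pow_le_pow_of_le_one hρ hρ1 (Nat.le_add_left s j)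
      · exact hβ1 x
    linarith
  induction j generalizing x η with
  | zero =>
    refine hlow 0 x ?_
    rw [pow_zero, mul_one] at hj
    linarith
  | succ j ih =>
    by_cases hb : β x ≤ b / 2
    · exact hlow (j + 1) x hb
    · push Not at hb
      -- Off an event of probability `ε` the guaranteed distance `η` becomes `(1 + κ) * η`, with one
      -- growth step fewer left.
      have h := sum_mul_le_add_of_le hP (hgrow x hb (hη.trans hx))
        (iterExpect_le_one hP hP1 hf1 (j + s))
        (k := fun _ => (j + s : ℕ) * ε + ρ ^ s * n) (fun y => by positivity)
        (fun y hy => ih y ((1 + κ) * η) (by nlinarith) (by nlinarith)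
          (by rw [pow_succ] at hj; linarith))
      rw [← sum_mul, hP1] at h
      rw [Nat.add_right_comm]
      refine h.trans (le_of_eq ?_)
      push_cast
      ring

end Kernel

/-! ### From the path law of the process to kernel expectations. -/

section Law

variable {V : Type*} [Fintype V] [DecidableEq V] {G : SimpleGraph V} {q₀ q₁ : ℝ} {x₀ : V → Bool}
  {Ω : Type*} [MeasurableSpace Ω] {μ : Measure Ω} [IsProbabilityMeasure μ] {X : ℕ → Ω → V → Bool}

theorem measureReal_eq_sum_inter_fiber {Y : Ω → V → Bool} (hY : Measurable Y) (A : Set Ω) :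
    μ.real A = ∑ z, μ.real {ω | Y ω = z ∧ ω ∈ A} := by
  have h := sum_measureReal_preimage_singleton (μ := μ.restrict A) (f := Y) univ
    (fun y _ => hY (measurableSet_singleton y))
  rw [coe_univ, Set.preimage_univ, measureReal_restrict_apply_univ] at h
  rw [← h]
  refine sum_congr rfl fun z _ => ?_
  rw [measureReal_restrict_apply (hY (measurableSet_singleton z))]
  rfl

/-- The definition gives only paths from time `0`. Summing out the earliest state, one time at a
time, yields the Markov property on later windows. -/
theorem IsProcess.window (hX : IsProcess G q₀ q₁ x₀ μ X) (r t : ℕ) (hrt : r ≤ t)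
    (y : ℕ → V → Bool) :
    μ.real {ω | ∀ s, r ≤ s → s ≤ t → X s ω = y s} =
      μ.real {ω | X r ω = y r} * ∏ s ∈ Ico r t, transProb G q₀ q₁ (y s) (y (s + 1)) := by
  induction r generalizing t y with
  | zero =>
    have h := hX.path t y
    have h0 := hX.path 0 y
    simp only [Nat.le_zero, forall_eq, range_zero, prod_empty] at h0
    rw [h0, Nat.Ico_zero_eq_range]
    simp only [Nat.zero_le, true_imp_iff]
    rw [h]
    split_ifs <;> simp
  | succ r ih =>
    -- Only the first transition involves the removed state `z`. The resulting sum over `z` does not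
    -- depend on `t`, and `t = r + 1` identifies it as the law at time `r + 1`.
    have key : ∀ t, r + 1 ≤ t → μ.real {ω | ∀ s, r + 1 ≤ s → s ≤ t → X s ω = y s} =
        (∑ z, μ.real {ω | X r ω = z} * transProb G q₀ q₁ z (y (r + 1))) *
          ∏ s ∈ Ico (r + 1) t, transProb G q₀ q₁ (y s) (y (s + 1)) := by
      intro t ht
      rw [measureReal_eq_sum_inter_fiber (hX.measurable r), sum_mul]
      refine sum_congr rfl fun z _ => ?_
      have h := ih t (by omega) (Function.update y r z)
      rw [prod_eq_prod_Ico_succ_bot (by omega), Function.update_self,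
        Function.update_of_ne (by omega), ← mul_assoc] at h
      have h2 : ∏ s ∈ Ico (r + 1) t, transProb G q₀ q₁ (Function.update y r z s)
          (Function.update y r z (s + 1)) =
          ∏ s ∈ Ico (r + 1) t, transProb G q₀ q₁ (y s) (y (s + 1)) := by
        refine prod_congr rfl fun s hs => ?_
        have := (mem_Ico.1 hs).1
        rw [Function.update_of_ne (by omega), Function.update_of_ne (by omega)]
      rw [h2] at h
      rw [← h]
      congr 1
      ext ω
      simp only [Set.mem_ofPred_eq]
      constructor
      · rintro ⟨h1, h2⟩ s hs hst
        rcases hs.eq_or_lt with rfl | hs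
        · simpa using h1
        · rw [Function.update_of_ne (by omega)]
          exact h2 s hs hst
      · intro h1
        refine ⟨by simpa using h1 r le_rfl (by omega), fun s hs hst => ?_⟩
        have := h1 s (by omega) hst
        rwa [Function.update_of_ne (by omega)] at this
    have h1 := key (r + 1) le_rfl
    rw [Ico_self, prod_empty, mul_one] at h1
    rw [key t hrt, ← h1]
    refine congrArg (· * _) (congrArg μ.real (Set.ext fun ω => ?_))
    simp only [Set.mem_ofPred_eq]
    exact ⟨fun h => h (r + 1) le_rfl le_rfl, fun h s hs hs' => by
      obtain rfl : s = r + 1 := by omega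
      exact h⟩

/-- The joint law of the process at two consecutive times. -/
theorem IsProcess.pair (hX : IsProcess G q₀ q₁ x₀ μ X) (t : ℕ) (y z : V → Bool) :
    μ.real {ω | X t ω = y ∧ X (t + 1) ω = z} =
      μ.real {ω | X t ω = y} * transProb G q₀ q₁ y z := by
  have h := hX.window t (t + 1) (by omega) (fun s => if s = t then y else z)
  simp only [Nat.Ico_succ_singleton, prod_singleton, if_true, Nat.succ_ne_self, if_false] at h
  rw [← h]
  congr 1
  ext ω
  simp only [Set.mem_ofPred_eq]
  constructor
  · rintro ⟨h1, h2⟩ s hs hs'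
    obtain rfl | rfl : s = t ∨ s = t + 1 := by omega
    · simpa using h1
    · simpa using h2
  · intro h1
    exact ⟨by simpa using h1 t le_rfl (by omega), by simpa using h1 (t + 1) (by omega) le_rfl⟩

theorem IsProcess.sum_mul_eq_iterExpect (hX : IsProcess G q₀ q₁ x₀ μ X) (f : (V → Bool) → ℝ)
    (T : ℕ) :
    ∑ y, μ.real {ω | X T ω = y} * f y = iterExpect (transProb G q₀ q₁) f T x₀ := by
  have key : ∀ s t, ∑ y, μ.real {ω | X (t + s) ω = y} * f y =
      ∑ y, μ.real {ω | X t ω = y} * iterExpect (transProb G q₀ q₁) f s y := by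
    intro s
    induction s with
    | zero => intro t; rfl
    | succ s ih =>
      intro t
      rw [show t + (s + 1) = t + 1 + s by omega, ih]
      have h : ∀ z, μ.real {ω | X (t + 1) ω = z} =
          ∑ y, μ.real {ω | X t ω = y} * transProb G q₀ q₁ y z := by
        intro z
        rw [measureReal_eq_sum_inter_fiber (hX.measurable t)]
        exact sum_congr rfl fun y _ => hX.pair t y z
      simp only [h, sum_mul, iterExpect, mul_sum]
      rw [sum_comm]
      exact sum_congr rfl fun y _ => sum_congr rfl fun z _ => by ring
  have h0 : ∀ y, μ.real {ω | X 0 ω = y} = if y = x₀ then 1 else 0 := by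
    intro y
    have h := hX.path 0 (fun _ => y)
    simpa using h
  have h := key T 0
  rw [zero_add] at h
  rw [h]
  simp [h0]

/-- Whether the configuration is not yet the consensus on opinion `1`. -/
def missIndicator (x : V → Bool) : ℝ := if x = fun _ => true then 0 else 1

/-- Consensus is absorbing, so it is enough to control the configuration at one time. -/
theorem IsProcess.one_sub_iterExpect_le (hX : IsProcess G q₀ q₁ x₀ μ X) {d : ℕ}
    (hd : ∀ u, (nbrs G u).card = d) (hd0 : 0 < d) (T : ℕ) :
    1 - iterExpect (transProb G q₀ q₁) missIndicator T x₀ ≤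
      μ.real {ω | ∀ s ≥ T, ∀ u, X s ω u = true} := by
  have habs : ∀ᵐ ω ∂μ, ∀ t, X t ω = (fun _ => true) → X (t + 1) ω = fun _ => true := by
    rw [ae_all_iff]
    intro t
    have h : ∀ᵐ ω ∂μ, ∀ z : V → Bool, z ≠ (fun _ => true) →
        ¬ (X t ω = (fun _ => true) ∧ X (t + 1) ω = z) := by
      rw [ae_all_iff]
      intro z
      by_cases hz : z = fun _ => true
      · simp [hz]
      · have h := hX.pair t (fun _ => true) z
        rw [transProb_consensus hd hd0 hz, mul_zero, measureReal_eq_zero_iff] at h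
        filter_upwards [measure_eq_zero_iff_ae_notMem.1 h] with ω hω _
        exact hω
    filter_upwards [h] with ω hω h1
    by_contra h2
    exact hω _ h2 ⟨h1, rfl⟩
  have hT : μ.real {ω | X T ω = fun _ => true} ≤
      μ.real {ω | ∀ s ≥ T, ∀ u, X s ω u = true} := by
    refine ENNReal.toReal_mono (measure_ne_top _ _) (measure_mono_ae ?_)
    filter_upwards [habs] with ω hω h1 s hs u
    have : ∀ k, X (T + k) ω = fun _ => true := by
      intro k
      induction k with
      | zero => exact h1
      | succ k ih => exact hω _ ih
    rw [← Nat.add_sub_cancel' hs, this]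
  refine le_trans (le_of_eq ?_) hT
  rw [← hX.sum_mul_eq_iterExpect]
  have h1 := measureReal_eq_sum_inter_fiber (μ := μ) (hX.measurable T) Set.univ
  simp only [probReal_univ, Set.mem_univ, and_true] at h1
  rw [h1, ← sum_sub_distrib, sum_eq_single fun _ => true]
  · simp [missIndicator]
  · intro y _ hy
    simp [missIndicator, hy]
  · simp

end Law

/-! ### The two phases for the fraction of zeros. -/

section Consensus

variable {V : Type*} [Fintype V] {G : SimpleGraph V} {d : ℕ} {q₀ q₁ c : ℝ}

/-- The fraction of agents with opinion `0`. -/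
def zeroFrac (x : V → Bool) : ℝ := numZeros x / Fintype.card V

/-- The critical fraction of zeros, below which this fraction decreases in expectation; `L` is the
square of the second eigenvalue. -/
def criticalFrac (q₀ q₁ L : ℝ) : ℝ := (q₀ / (q₀ + q₁) - L) / (1 - L)

theorem numZeros_nonneg (x : V → Bool) : 0 ≤ numZeros x := by
  rw [numZeros]
  positivity

theorem zeroFrac_nonneg (x : V → Bool) : 0 ≤ zeroFrac x :=
  div_nonneg (numZeros_nonneg x) (by positivity)

theorem zeroFrac_le_one (x : V → Bool) : zeroFrac x ≤ 1 := by
  refine div_le_one_of_le₀ ?_ (by positivity)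
  have := numOnes_add_numZeros x
  have : (0 : ℝ) ≤ numOnes x := by positivity
  linarith

theorem missIndicator_le (hV : 0 < Fintype.card V) (x : V → Bool) :
    missIndicator x ≤ Fintype.card V * zeroFrac x := by
  have hn : (Fintype.card V : ℝ) ≠ 0 := by positivity
  rw [zeroFrac, mul_div_cancel₀ _ hn, missIndicator]
  split_ifs with h
  · exact numZeros_nonneg x
  · obtain ⟨u, hu⟩ := Function.ne_iff.1 h
    have hu' : x u = false := by simpa using hu
    have := single_le_sum (f := fun u => if x u = false then (1 : ℝ) else 0)
      (fun v _ => by positivity) (mem_univ u)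
    simpa only [numZeros, hu', if_true] using this

theorem missIndicator_le_one (x : V → Bool) : missIndicator x ≤ 1 := by
  rw [missIndicator]
  split_ifs <;> norm_num

/-- Logistic form of the drift: the critical fraction is where `(1 - L) (1 - β)` equals `p`. -/
theorem sum_agentProb_false_div_card_le (hd : ∀ u, (nbrs G u).card = d) (hd0 : 0 < d)
    (hlam : secondEigenvalue G d < 1) (hV : 0 < Fintype.card V) (h0 : 0 < q₀) (h1 : 0 < q₁)
    (x : V → Bool) :
    (∑ u, agentProb G q₀ q₁ x u false) / Fintype.card V ≤ zeroFrac x - q₁ *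
      (1 - secondEigenvalue G d ^ 2) * zeroFrac x *
        (criticalFrac q₀ q₁ (secondEigenvalue G d ^ 2) - zeroFrac x) := by
  have hn : (0 : ℝ) < Fintype.card V := by positivity
  have hL : 1 - secondEigenvalue G d ^ 2 ≠ 0 := by
    nlinarith [secondEigenvalue_nonneg G d]
  have h := sum_agentProb_false_le hd hd0 hlam hV h0 h1 x
  rw [div_le_iff₀ hn]
  refine h.trans (le_of_eq ?_)
  have hz : numZeros x = zeroFrac x * Fintype.card V := by rw [zeroFrac]; field_simp
  have hb : (1 - secondEigenvalue G d ^ 2) * criticalFrac q₀ q₁ (secondEigenvalue G d ^ 2) =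
      1 - q₁ / (q₀ + q₁) - secondEigenvalue G d ^ 2 := by
    rw [criticalFrac, mul_div_cancel₀ _ hL]
    field_simp
    ring
  rw [← zeroFrac, hz]
  linear_combination (q₁ * zeroFrac x * Fintype.card V) * hb

variable [DecidableEq V]

theorem sum_transProb_upper_tail (hd : ∀ u, (nbrs G u).card = d) (hd0 : 0 < d)
    (hV : 0 < Fintype.card V) (h0 : 0 ≤ q₀) (h1 : 0 ≤ q₁) (h0' : q₀ ≤ 1) (h1' : q₁ ≤ 1)
    (x : V → Bool) {δ w : ℝ} (hδ : 0 ≤ δ) (hδ2 : δ ≤ 2)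
    (hw : (∑ u, agentProb G q₀ q₁ x u false) / Fintype.card V + δ ≤ w) :
    ∑ y with w < zeroFrac y, transProb G q₀ q₁ x y ≤
      Real.exp (-(δ ^ 2 * Fintype.card V / 4)) := by
  have hn : (0 : ℝ) < Fintype.card V := by positivity
  have hp0 := agentProb_nonneg (G := G) h0 h1 h0' h1' x
  refine le_trans ?_ (sum_prod_weights_upper_tail
    (agentProb_true_add_false (q₀ := q₀) (q₁ := q₁) hd hd0 x) hp0 hδ hδ2)
  refine sum_le_sum_of_subset_of_nonneg (fun y hy => ?_)
    fun y _ _ => prod_nonneg fun u _ => hp0 u _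
  simp only [mem_filter, mem_univ, true_and] at hy ⊢
  have h := hw.trans_lt hy
  rw [zeroFrac, lt_div_iff₀ hn, add_mul, div_mul_cancel₀ _ hn.ne'] at h
  exact h

/-- The probability of no consensus after `j + s` steps. -/
theorem iterExpect_missIndicator_le (hd : ∀ u, (nbrs G u).card = d) (hd0 : 0 < d)
    (hV : 0 < Fintype.card V) (h1 : 0 < q₁) (h01 : q₁ < q₀) (h0' : q₀ ≤ 1) (hc : 0 < c)
    (hL : secondEigenvalue G d ^ 2 ≤ q₀ / (q₀ + q₁) - c) {η : ℝ} (hη : 0 ≤ η) (x : V → Bool)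
    (hx : η ≤ criticalFrac q₀ q₁ (secondEigenvalue G d ^ 2) - zeroFrac x) (j s : ℕ)
    (hj : criticalFrac q₀ q₁ (secondEigenvalue G d ^ 2) / 2 ≤ η * (1 + q₁ * c / 4) ^ j) :
    iterExpect (transProb G q₀ q₁) missIndicator (j + s) x ≤
      (j + s : ℕ) * Real.exp (-((q₁ * c / 4 * η) ^ 2 * Fintype.card V / 4)) +
        (1 - q₁ * c / 2) ^ s * Fintype.card V := by
  have h0 : 0 < q₀ := h1.trans h01
  have hQ : q₀ / (q₀ + q₁) < 1 := by
    rw [div_lt_one (by positivity)]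
    linarith
  have hlam0 := secondEigenvalue_nonneg G d
  have hlam : secondEigenvalue G d < 1 := by nlinarith
  have hdrift := sum_agentProb_false_div_card_le (q₀ := q₀) (q₁ := q₁) hd hd0 hlam hV h0 h1
  have htail := fun (x : V → Bool) {δ w : ℝ} => sum_transProb_upper_tail (q₀ := q₀) (q₁ := q₁)
    hd hd0 hV h0.le h1.le h0' (by linarith) x (δ := δ) (w := w)
  set L := secondEigenvalue G d ^ 2
  have hL0 : 0 ≤ L := sq_nonneg _
  set b := criticalFrac q₀ q₁ L with hb
  have hM : 0 < 1 - L := by linarith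
  have hMb : (1 - L) * b = q₀ / (q₀ + q₁) - L := by
    rw [hb, criticalFrac, mul_div_cancel₀ _ hM.ne']
  have hcb : c ≤ (1 - L) * b := by linarith
  have hb0 : 0 < b := by
    by_contra h
    nlinarith
  have hb1 : b ≤ 1 := by
    rw [hb, criticalFrac, div_le_one hM]
    linarith
  have hq1 : q₁ ≤ 1 := by linarith
  have hκ1 : q₁ * c / 4 ≤ 1 / 4 := by nlinarith
  set κ := q₁ * c / 4 with hκ
  have hκ0 : 0 < κ := by positivity
  have hηb : η ≤ b := by linarith [zeroFrac_nonneg x]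
  set n : ℝ := (Fintype.card V : ℝ) with hn
  have hexp : ∀ δ, κ * η ≤ δ →
      Real.exp (-(δ ^ 2 * n / 4)) ≤ Real.exp (-((κ * η) ^ 2 * n / 4)) := by
    intro δ hδ
    gcongr
  have hP : ∀ x y, 0 ≤ transProb G q₀ q₁ x y := fun x y =>
    prod_nonneg fun u _ => agentProb_nonneg h0.le h1.le h0' hq1 x u _
  have hP1 : ∀ x, ∑ y, transProb G q₀ q₁ x y = 1 := fun x =>
    sum_prod_weights (agentProb_true_add_false hd hd0 x)
  have hcontr : ∀ x : V → Bool, zeroFrac x ≤ b / 2 →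
      (∑ u, agentProb G q₀ q₁ x u false) / n ≤ (1 - q₁ * c / 2) * zeroFrac x := by
    intro x hx
    refine (hdrift x).trans ?_
    have hz := zeroFrac_nonneg x
    have h2 : c / 2 ≤ (1 - L) * (b - zeroFrac x) := by nlinarith
    nlinarith [mul_le_mul_of_nonneg_left h2 (mul_nonneg h1.le hz)]
  -- In both phases `(1 - L) b ≥ c` yields a drift of rate `2κ`; half is kept and half absorbs the
  -- fluctuation. The allowed deviations `κ b` and `κ (b - β)` are at least `κ η`, so one `ε` serves
  -- throughout.
  refine iterExpect_le_of_growth (β := zeroFrac) (b := b) (η₀ := η) (κ := κ) (ρ := 1 - q₁ * c / 2)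
    hP hP1 missIndicator_le_one zeroFrac_nonneg zeroFrac_le_one (by positivity)
    (missIndicator_le hV) (by linarith) (by linarith) (by positivity) hκ0.le hη
    ?_ ?_ ?_ j s x η le_rfl hx hj
  · intro x hx
    refine le_trans (le_of_eq ?_) (hcontr x hx)
    rw [← sum_prod_weights_mul_numZeros (agentProb_true_add_false hd hd0 x), sum_div]
    exact sum_congr rfl fun y _ => by rw [zeroFrac, mul_div_assoc]; rfl
  · intro x hx
    refine (htail x (δ := κ * b) (by positivity) (by nlinarith) ?_).trans
      (hexp _ (by gcongr))
    have := hcontr x hx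
    nlinarith
  · intro x hx hx2
    refine (htail x (δ := κ * (b - zeroFrac x)) (by have := hη.trans hx2; positivity) ?_ ?_).trans
      (hexp _ (by gcongr))
    · nlinarith [zeroFrac_nonneg x]
    · have h2 := hdrift x
      have h3 : c / 2 ≤ (1 - L) * zeroFrac x := by nlinarith
      have h4 := mul_le_mul_of_nonneg_left h3 (mul_nonneg h1.le (hη.trans hx2))
      nlinarith

end Consensus

/-! ### Initial distance, running time and choice of constants. -/

section Main

/-- The initial distance of the fraction of zeros from the critical fraction. -/
theorem criticalFrac_mul_le {V : Type*} [Fintype V] {q₀ q₁ L σ : ℝ} (hV : 0 < Fintype.card V)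
    (h0 : 0 < q₀) (h1 : 0 < q₁) (hL : L < q₀ / (q₀ + q₁)) (x : V → Bool)
    (hx : q₁ / (q₀ + q₁) + max L σ ≤ (numOnes x : ℝ) / Fintype.card V) :
    criticalFrac q₀ q₁ L * σ ≤ criticalFrac q₀ q₁ L - zeroFrac x := by
  have hn : (Fintype.card V : ℝ) ≠ 0 := by positivity
  have hQ : q₀ / (q₀ + q₁) = 1 - q₁ / (q₀ + q₁) := by
    field_simp
    ring
  have hp : 0 < q₁ / (q₀ + q₁) := by positivity
  have hz : zeroFrac x = 1 - numOnes x / Fintype.card V := by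
    rw [zeroFrac, eq_sub_of_add_eq' (numOnes_add_numZeros x)]
    field_simp
  have hM : 0 < 1 - L := by linarith
  have hMb : (1 - L) * criticalFrac q₀ q₁ L = q₀ / (q₀ + q₁) - L := by
    rw [criticalFrac, mul_div_cancel₀ _ hM.ne']
  set b := criticalFrac q₀ q₁ L
  have hb0 : 0 < b := by
    by_contra h
    nlinarith
  set p := q₁ / (q₀ + q₁)
  have hmL := le_max_left L σ
  have hmσ := le_max_right L σ
  set e := max L σ
  -- The two sides differ by `p (e - L)`; this is where `λ²` in the maximum is needed.
  have h2 : (1 - L) * (b * e) ≤ (1 - L) * (b - (1 - p - e)) := by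
    have h3 : (1 - L) * (b * e) = (1 - p - L) * e := by
      rw [← mul_assoc, hMb, hQ]
    have h4 : (1 - L) * (b - (1 - p - e)) = (1 - L) * b - (1 - L) * (1 - p - e) := by ring
    rw [h3, h4, hMb, hQ]
    nlinarith
  have h3 := le_of_mul_le_mul_left h2 hM
  have h4 : b * σ ≤ b * e := by gcongr
  linarith

theorem exp_half_le_one_add {κ : ℝ} (h0 : 0 ≤ κ) (h1 : κ ≤ 1) : Real.exp (κ / 2) ≤ 1 + κ := by
  have := Real.abs_exp_sub_one_sub_id_le (x := κ / 2) (by rw [abs_le]; constructor <;> linarith)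
  nlinarith [(abs_le.1 this).2]

/-- The number of steps in each of the two phases, against the time bound of the theorem. -/
theorem two_mul_ceil_le {q₀ q₁ c γ ℓ : ℝ} (h1 : 0 < q₁) (h01 : q₁ < q₀) (h0' : q₀ ≤ 1)
    (hc : 0 < c) (hcQ : c < q₀ / (q₀ + q₁)) (hγ : 0 < γ) (hγc : γ ≤ c) (hℓ : 1 ≤ ℓ) :
    ((⌈ℓ / (q₁ * c / 4)⌉₊ + ⌈ℓ / (q₁ * c / 4)⌉₊ : ℕ) : ℝ) ≤
      32 * (ℓ / Real.log (1 / (1 - q₁ * c * (q₀ / (q₀ + q₁) - γ)))) := by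
  have hQ1 : q₀ / (q₀ + q₁) < 1 := by
    rw [div_lt_one (by linarith)]
    linarith
  have hqQ : q₁ * (q₀ / (q₀ + q₁)) ≤ 1 / 2 := by
    rw [← mul_div_assoc, div_le_iff₀ (by linarith)]
    nlinarith
  set Q := q₀ / (q₀ + q₁)
  have hκ : 0 < q₁ * c / 4 := by positivity
  have hκ1 : q₁ * c / 4 ≤ 1 := by nlinarith
  have hceil := (Nat.ceil_lt_add_one (by positivity : 0 ≤ ℓ / (q₁ * c / 4))).le
  have h1' : 1 ≤ ℓ / (q₁ * c / 4) := by
    rw [le_div_iff₀ hκ]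
    linarith
  set x := q₁ * c * (Q - γ) with hx
  have hx0 : 0 < x := mul_pos (by positivity) (by linarith)
  have hxc : x ≤ q₁ * c := by
    rw [hx]
    exact mul_le_of_le_one_right (by positivity) (by linarith)
  have hx2 : x ≤ 1 / 2 := by nlinarith
  have hlog0 : 0 < Real.log (1 / (1 - x)) := by
    refine Real.log_pos ?_
    rw [lt_div_iff₀ (by linarith)]
    linarith
  -- Here `log y ≤ y - 1`, and `x ≤ 1 / 2` gives `1 / (1 - x) ≤ 1 + 2x`.
  have hlog : Real.log (1 / (1 - x)) ≤ 2 * (q₁ * c) := by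
    refine (Real.log_le_sub_one_of_pos (by have : 0 < 1 - x := by linarith
                                           positivity)).trans ?_
    have : 1 / (1 - x) ≤ 1 + 2 * x := by
      rw [div_le_iff₀ (by linarith)]
      nlinarith
    linarith
  push_cast
  -- As `ℓ / κ ≥ 1`, rounding up at most doubles each phase.
  calc _ ≤ 4 * (ℓ / (q₁ * c / 4)) := by linarith
    _ = 32 * (ℓ / (2 * (q₁ * c))) := by
        field_simp
        norm_num
    _ ≤ _ := by gcongr

/-- The failure probability of both phases is polynomially small. -/
theorem failure_bound {κ a ℓ m : ℝ} (hκ : 0 < κ) (hκ1 : κ ≤ 1) (ha : 0 < a) (ha1 : a ≤ 1)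
    (hℓ : 1 ≤ ℓ) (hm : m ≤ ℓ / κ + 1) :
    (m + m) * Real.exp (-(a * ℓ)) + Real.exp (-ℓ) ≤
      (8 / (κ * a) + 3) * Real.exp (-(a / 2 * ℓ)) := by
  have h1 : 1 ≤ ℓ / κ := by
    rw [le_div_iff₀ hκ]
    linarith
  have h2 : a / 2 * ℓ ≤ Real.exp (a / 2 * ℓ) := by
    linarith [Real.add_one_le_exp (a / 2 * ℓ)]
  -- Half of the exponent pays for the number of steps.
  have h3 : m + m ≤ 8 / (κ * a) * Real.exp (a / 2 * ℓ) := by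
    calc m + m ≤ 4 * (ℓ / κ) := by linarith
      _ = 8 / (κ * a) * (a / 2 * ℓ) := by
        field_simp
        norm_num
      _ ≤ _ := by gcongr
  have h4 : Real.exp (-ℓ) ≤ Real.exp (-(a / 2 * ℓ)) := by
    gcongr
    nlinarith
  have h5 : Real.exp (a / 2 * ℓ) * Real.exp (-(a * ℓ)) = Real.exp (-(a / 2 * ℓ)) := by
    rw [← Real.exp_add]
    congr 1
    ring
  have h6 := mul_le_mul_of_nonneg_right h3 (Real.exp_pos (-(a * ℓ))).le
  rw [mul_assoc, h5] at h6
  linarith [Real.exp_pos (-(a / 2 * ℓ))]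

/-- The probability of no consensus within the time of the theorem. -/
theorem iterExpect_missIndicator_le_rpow {V : Type*} [Fintype V] [DecidableEq V]
    {G : SimpleGraph V} {d : ℕ} {q₀ q₁ c : ℝ} (hd : ∀ u, (nbrs G u).card = d) (hd0 : 0 < d)
    (hV : 3 ≤ Fintype.card V) (h1 : 0 < q₁) (h01 : q₁ < q₀) (h0' : q₀ ≤ 1) (hc : 0 < c)
    (hL : secondEigenvalue G d ^ 2 ≤ q₀ / (q₀ + q₁) - c) (x : V → Bool)
    (hx : q₁ / (q₀ + q₁) + max (secondEigenvalue G d ^ 2)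
        (Real.sqrt (Real.log (Fintype.card V) / (4 * (Fintype.card V : ℝ)))) ≤
      (numOnes x : ℝ) / Fintype.card V) (m : ℕ)
    (hm : m = ⌈Real.log (Fintype.card V) / (q₁ * c / 4)⌉₊) :
    iterExpect (transProb G q₀ q₁) missIndicator (m + m) x ≤
      (8 / (q₁ * c / 4 * ((q₁ * c / 4 * c) ^ 2 / 16)) + 3) /
        (Fintype.card V : ℝ) ^ ((q₁ * c / 4 * c) ^ 2 / 16 / 2) := by
  have h0 : 0 < q₀ := h1.trans h01
  have hQ1 : q₀ / (q₀ + q₁) < 1 := by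
    rw [div_lt_one (by linarith)]
    linarith
  have hL0 : 0 ≤ secondEigenvalue G d ^ 2 := sq_nonneg _
  have hstart := criticalFrac_mul_le (by omega) h0 h1 (by linarith) x hx
  have hn3 : (3 : ℝ) ≤ Fintype.card V := by exact_mod_cast hV
  have hmain := fun η hη hη' hj => iterExpect_missIndicator_le (q₀ := q₀) (q₁ := q₁) (c := c)
    hd hd0 (by omega) h1 h01 h0' hc hL (η := η) hη x hη' m m hj
  set n : ℝ := (Fintype.card V : ℝ)
  set ℓ := Real.log n with hℓ
  have hn0 : 0 < n := by linarith
  have hexpℓ : Real.exp ℓ = n := Real.exp_log hn0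
  have hℓ1 : 1 ≤ ℓ := by
    rw [hℓ, Real.le_log_iff_exp_le hn0]
    linarith [Real.exp_one_lt_d9]
  set L := secondEigenvalue G d ^ 2
  have hM : 0 < 1 - L := by linarith
  have hcb : c ≤ criticalFrac q₀ q₁ L := by
    rw [criticalFrac, le_div_iff₀ hM]
    nlinarith
  set b := criticalFrac q₀ q₁ L
  have hb0 : 0 < b := hc.trans_le hcb
  set σ := Real.sqrt (ℓ / (4 * n)) with hσ
  have hσ0 : 0 ≤ σ := Real.sqrt_nonneg _
  have hσ2 : σ ^ 2 = ℓ / (4 * n) := Real.sq_sqrt (by positivity)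
  set κ := q₁ * c / 4 with hκ
  have hκ0 : 0 < κ := by positivity
  have hκ1 : κ ≤ 1 := by nlinarith
  set a := (κ * c) ^ 2 / 16 with ha
  have ha0 : 0 < a := by positivity
  have hκc : κ * c ≤ 1 := by nlinarith
  have ha1 : a ≤ 1 := by
    have : 0 ≤ κ * c := by positivity
    nlinarith
  have hmle : ℓ / κ ≤ m := hm ▸ Nat.le_ceil _
  have hmκ : ℓ ≤ m * κ := by rwa [div_le_iff₀ hκ0] at hmle
  -- Since `log n ≥ 1`, `σ ≥ 1 / (2 √n)`, and `m κ ≥ log n` makes the growth factor at least `√n`.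
  have hgrow : b / 2 ≤ b * σ * (1 + κ) ^ m := by
    have h2 : Real.exp (-(ℓ / 2)) ≤ 2 * σ := by
      refine (sq_le_sq₀ (Real.exp_pos _).le (by positivity)).1 ?_
      rw [mul_pow, hσ2, ← Real.exp_nat_mul]
      have : ((2 : ℕ) : ℝ) * -(ℓ / 2) = -ℓ := by push_cast; ring
      rw [this, Real.exp_neg, hexpℓ]
      field_simp
      linarith
    have h3 : Real.exp (ℓ / 2) ≤ (1 + κ) ^ m := by
      calc Real.exp (ℓ / 2) ≤ Real.exp (m * (κ / 2)) := by gcongr; linarith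
        _ = Real.exp (κ / 2) ^ m := Real.exp_nat_mul _ _
        _ ≤ _ := by
          gcongr
          exact exp_half_le_one_add hκ0.le hκ1
    have h4 : 1 ≤ 2 * σ * (1 + κ) ^ m := by
      calc (1 : ℝ) = Real.exp (-(ℓ / 2)) * Real.exp (ℓ / 2) := by rw [← Real.exp_add]; simp
        _ ≤ _ := by gcongr
    nlinarith
  have h := hmain (b * σ) (by positivity) hstart hgrow
  -- `σ² = log n / (4n)` cancels `n`, leaving a power of `n`; `c ≤ b` makes its exponent independent
  -- of the graph.
  have hε : Real.exp (-((κ * (b * σ)) ^ 2 * n / 4)) ≤ Real.exp (-(a * ℓ)) := by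
    have : (κ * (b * σ)) ^ 2 * n / 4 = (κ * b) ^ 2 / 16 * ℓ := by
      rw [← mul_assoc, mul_pow _ σ, hσ2]
      field_simp
      norm_num
    rw [this, ha]
    gcongr
  -- The contraction gains `n⁻²`, against the factor `n` from the first moment.
  have hρ : (1 - q₁ * c / 2) ^ m * n ≤ Real.exp (-ℓ) := by
    have h2 : 1 - q₁ * c / 2 ≤ Real.exp (-(2 * κ)) := by
      have := Real.add_one_le_exp (-(2 * κ))
      linarith
    have h3 : 0 ≤ 1 - q₁ * c / 2 := by
      have : q₁ * c ≤ 1 := by nlinarith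
      linarith
    calc (1 - q₁ * c / 2) ^ m * n ≤ Real.exp (-(2 * κ)) ^ m * Real.exp ℓ := by
          rw [hexpℓ]
          gcongr
      _ = Real.exp (m * -(2 * κ) + ℓ) := by rw [← Real.exp_nat_mul, ← Real.exp_add]
      _ ≤ _ := by
          gcongr
          linarith
  have hmle' : (m : ℝ) ≤ ℓ / κ + 1 := hm ▸ (Nat.ceil_lt_add_one (by positivity)).le
  have hrpow : n ^ (a / 2) = Real.exp (a / 2 * ℓ) := by
    rw [Real.rpow_def_of_pos hn0, mul_comm]
  rw [hrpow, div_eq_mul_inv, ← Real.exp_neg]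
  refine le_trans ?_ (failure_bound hκ0 hκ1 ha0 ha1 hℓ1 hmle')
  refine h.trans ?_
  push_cast
  gcongr

end Main

end BiasedTwoChoices

end

theorem theorem2 :
    ∃ K : ℝ, 0 < K ∧
      ∀ q₀ q₁ c γ : ℝ, 0 < q₁ → q₁ < q₀ → q₀ ≤ 1 →
        0 < c → c < q₀ / (q₀ + q₁) → 0 < γ → γ ≤ c →
        ∃ α : ℝ, 0 < α ∧ α < 1 ∧ ∃ C : ℝ, 0 < C ∧
          ∀ (lam : ℝ) (N d : ℕ → ℕ) (G : (k : ℕ) → SimpleGraph (Fin (N k))),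
            BiasedTwoChoices.IsExpanderFamily lam N d G →
            lam ^ 2 ≤ q₀ / (q₀ + q₁) - c →
            ∀ (k : ℕ) (x₀ : Fin (N k) → Bool),
              q₁ / (q₀ + q₁) +
                  max (BiasedTwoChoices.secondEigenvalue (G k) (d k) ^ 2)
                    (Real.sqrt (Real.log (N k) / (4 * (N k : ℝ)))) ≤
                (BiasedTwoChoices.numOnes x₀ : ℝ) / (N k : ℝ) →
              (BiasedTwoChoices.numOnes x₀ : ℝ) / (N k : ℝ) ≤ 1 - γ →
              ∀ (Ω : Type*) [MeasurableSpace Ω] (μ : MeasureTheory.Measure Ω)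
                [MeasureTheory.IsProbabilityMeasure μ] (X : ℕ → Ω → Fin (N k) → Bool),
                BiasedTwoChoices.IsProcess (G k) q₀ q₁ x₀ μ X →
                1 - C / (N k : ℝ) ^ α ≤
                  μ.real {ω | ∃ t : ℕ,
                    (t : ℝ) ≤ K * (Real.log (N k) /
                      Real.log (1 / (1 - q₁ * c * (q₀ / (q₀ + q₁) - γ)))) ∧
                    ∀ s ≥ t, ∀ u, X s ω u = true} := by
  refine ⟨32, by norm_num, fun q₀ q₁ c γ h1 h01 h0' hc hcQ hγ hγc => ?_⟩
  have h0 : 0 < q₀ := h1.trans h01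
  have hQ1 : q₀ / (q₀ + q₁) < 1 := by
    rw [div_lt_one (by linarith)]
    linarith
  have hα1 : (q₁ * c / 4 * c) ^ 2 / 16 / 2 < 1 := by
    have h2 : q₁ * c ≤ 1 := by nlinarith
    have h3 : q₁ * c / 4 * c ≤ 1 := by nlinarith
    have h4 : 0 ≤ q₁ * c / 4 * c := by positivity
    nlinarith
  refine ⟨(q₁ * c / 4 * c) ^ 2 / 16 / 2, by positivity, hα1,
    8 / (q₁ * c / 4 * ((q₁ * c / 4 * c) ^ 2 / 16)) + 3, by positivity,
    fun lam N d G hG hlam k x₀ hx₀ _ Ω _ μ _ X hX => ?_⟩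
  -- On the empty graph the quotient in the initial condition is `0` by convention, below `q₁ / (q₀
  -- + q₁)`.
  rcases Nat.eq_zero_or_pos (N k) with hN0 | hN0
  · exfalso
    have hp : 0 < q₁ / (q₀ + q₁) := by positivity
    have hm := le_max_left (BiasedTwoChoices.secondEigenvalue (G k) (d k) ^ 2)
      (Real.sqrt (Real.log (N k) / (4 * (N k : ℝ))))
    have hs := sq_nonneg (BiasedTwoChoices.secondEigenvalue (G k) (d k))
    have hz : (BiasedTwoChoices.numOnes x₀ : ℝ) / (N k : ℝ) = 0 := by
      have h : (N k : ℝ) = 0 := by exact_mod_cast hN0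
      rw [h, div_zero]
    linarith
  -- The bound `log n ≥ 1` needs `n ≥ 3`. For smaller `n` the summand `3` in `C` makes the claimed
  -- probability nonpositive.
  rcases Nat.lt_or_ge (N k) 3 with hN | hN
  · refine le_trans ?_ measureReal_nonneg
    have hN1 : (1 : ℝ) ≤ N k := by exact_mod_cast hN0
    have hN2 : (N k : ℝ) ≤ 3 := by exact_mod_cast hN.le
    have h2 : (N k : ℝ) ^ ((q₁ * c / 4 * c) ^ 2 / 16 / 2) ≤ N k := by
      simpa using Real.rpow_le_rpow_of_exponent_le hN1 hα1.le
    have h3 : 0 < 8 / (q₁ * c / 4 * ((q₁ * c / 4 * c) ^ 2 / 16)) := by positivity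
    rw [sub_nonpos, one_le_div (by positivity)]
    linarith
  have hd : ∀ u, (BiasedTwoChoices.nbrs (G k) u).card = d k := by
    classical
    intro u
    rw [← hG.regular k u, ← SimpleGraph.card_neighborFinset_eq_degree]
    congr 1
    ext v
    simp [BiasedTwoChoices.nbrs]
  have hL : BiasedTwoChoices.secondEigenvalue (G k) (d k) ^ 2 ≤ q₀ / (q₀ + q₁) - c := by
    refine le_trans ?_ hlam
    have := BiasedTwoChoices.secondEigenvalue_nonneg (G k) (d k)
    have := hG.second_le k
    gcongr
  have hℓ : 1 ≤ Real.log (N k) := by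
    have : (3 : ℝ) ≤ N k := by exact_mod_cast hN
    rw [Real.le_log_iff_exp_le (by linarith)]
    linarith [Real.exp_one_lt_d9]
  have hT := BiasedTwoChoices.two_mul_ceil_le h1 h01 h0' hc hcQ hγ hγc hℓ
  have hmiss := BiasedTwoChoices.iterExpect_missIndicator_le_rpow hd (hG.degree_pos k)
    (by simpa using hN) h1 h01 h0' hc hL x₀ (by simpa using hx₀) _ rfl
  simp only [Fintype.card_fin] at hmiss
  have hproc := hX.one_sub_iterExpect_le hd (hG.degree_pos k)
    (⌈Real.log (N k) / (q₁ * c / 4)⌉₊ + ⌈Real.log (N k) / (q₁ * c / 4)⌉₊)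
  refine (sub_le_sub_left hmiss 1).trans (hproc.trans (measureReal_mono ?_))
  exact fun ω hω => ⟨_, hT, hω⟩
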